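/- Fix a type universe $\mathcal U$ (the ground universe of sets). Let $\mathcal P(\omega)^{\aleph_1}$ be the set of all functions $g:\aleph_1\to\mathcal P(\omega)$, with the topology $\tau$ whose basis consists of the sets $D_p=\{g : g \text{ extends } p\}$, where $p$ ranges over the partial functions from $\aleph_1$ to $\mathcal P(\omega)$ with countable domain. Let $\mathbb B_{\mathsf{collapse}}$ be the regular open algebra of $(\mathcal P(\omega)^{\aleph_1},\tau)$, that is, the complete Boolean algebra of open sets $U$ that equal the interior of their closure, with $U\sqcap V=U\cap V$, with $\neg U$ the complement of the closure of $U$, and with $\bigsqcup_i U_i$ the interior of the closure of $\bigcup_i U_i$. For a complete Boolean algebra $\mathbb B$ in $\mathcal U$, let $V^{\mathbb B}$ be the $\mathbb B$-valued universe: its elements are generated inductively as triples $x=\langle \alpha, A, b\rangle$ with $\alpha$ an index type in $\mathcal U$, $A$ a family of elements of $V^{\mathbb B}$ indexed by $\alpha$, and $b:\alpha\to\mathbb B$. Equality and membership have the truth values $$[\![x=x']\!]=\bigsqcap_{i}\Big(b(i)\Rightarrow\bigsqcup_{j} b'(j)\sqcap[\![A(i)=A'(j)]\!]\Big)\sqcap\bigsqcap_{j}\Big(b'(j)\Rightarrow\bigsqcup_{i}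 b(i)\sqcap[\![A(i)=A'(j)]\!]\Big),\qquad [\![y\in x]\!]=\bigsqcup_{i} b(i)\sqcap[\![y=A(i)]\!].$$ The language of set theory has the relation symbol $\in$ and function symbols for the empty set, $\omega$, power set, union and ordered pair, interpreted by the corresponding operations on $V^{\mathbb B}$ ($\omega$ by the canonical name of the set of finite von Neumann ordinals, $\mathcal P(x)$ by the set of the $\mathbb{B}$-valued subsets $\langle\alpha,A,\chi\rangle$ of $x=\langle\alpha,A,b\rangle$, $\chi:\alpha\to\mathbb B$, each with truth value $[\![\langle\alpha,A,\chi\rangle\subseteq x]\!]$). The truth value in $\mathbb B$ of a sentence is computed by interpreting connectives and quantifiers by the Boolean operations, infima and suprema of $\mathbb B$. Let $\mathsf{CH}$ be the sentence $$\forall x,\ \mathrm{Ord}(x)\Rightarrow \big(x\le\omega\ \vee\ \mathcal P(\omega)\le x\big),$$ where $\mathrm{Ord}(x)$ says that $x$ is transitive, that any two elements of $x$ are equal or one is a member of the other, and that $\in$ is well-founded on $x$ (every nonempty subset of $x$ has an $\in$-minimal element), and $x\le y$ says that there is a function from a subset of $y$ onto $x$. Then $\mathsf{CH}$ has truth value $\top$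 in $V^{\mathbb B_{\mathsf{collapse}}}$, i.e. $\top\Vdash_{V^{\mathbb B_{\mathsf{collapse}}}}\mathsf{CH}$. -/

import Mathlib

open FirstOrder FirstOrder.Language TopologicalSpace Ordinal

universe u v w w'

/-! ### Boolean-valued first-order semantics -/

/-- A `𝔹`-valued structure for a first-order language `L`: function symbols are interpreted by
functions, relation symbols by `𝔹`-valued predicates, and equality by a `𝔹`-valued congruence. -/
structure BStructure (L : FirstOrder.Language.{u, v}) (𝔹 : Type w) [CompleteBooleanAlgebra 𝔹] where
  carrier : Type w'
  funMap : ∀ {n : ℕ}, L.Functions n → (Fin n → carrier) → carrier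
  relMap : ∀ {n : ℕ}, L.Relations n → (Fin n → carrier) → 𝔹
  eqv : carrier → carrier → 𝔹
  eqv_refl : ∀ x, eqv x x = ⊤
  eqv_symm : ∀ x y, eqv x y = eqv y x
  eqv_trans : ∀ x y z, eqv x y ⊓ eqv y z ≤ eqv x z
  fun_congr : ∀ {n : ℕ} (f : L.Functions n) (x y : Fin n → carrier),
    ⨅ i, eqv (x i) (y i) ≤ eqv (funMap f x) (funMap f y)
  rel_congr : ∀ {n : ℕ} (R : L.Relations n) (x y : Fin n → carrier),
    (⨅ i, eqv (x i) (y i)) ⊓ relMap R x ≤ relMap R y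

namespace BStructure

variable {L : FirstOrder.Language.{u, v}} {𝔹 : Type w} [CompleteBooleanAlgebra 𝔹]

/-- The value of a term under an assignment of its variables. -/
def realizeTerm (M : BStructure.{u, v, w, w'} L 𝔹) {α : Type*} (a : α → M.carrier) :
    L.Term α → M.carrier
  | .var k => a k
  | .func f ts => M.funMap f fun i => M.realizeTerm a (ts i)

/-- The truth value in `𝔹` of a formula under an assignment `a` of its free variables and an
assignment `b` of its (de Bruijn) bound variables. -/
def realize (M : BStructure.{u, v, w, w'} L 𝔹) {α : Type*} (a : α → M.carrier) :
    ∀ {n : ℕ}, L.BoundedFormula α n → (Fin n → M.carrier) → 𝔹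
  | _, .falsum, _ => ⊥
  | _, .equal t₁ t₂, b =>
      M.eqv (M.realizeTerm (Sum.elim a b) t₁) (M.realizeTerm (Sum.elim a b) t₂)
  | _, .rel R ts, b => M.relMap R fun i => M.realizeTerm (Sum.elim a b) (ts i)
  | _, .imp φ ψ, b => M.realize a φ b ⇨ M.realize a ψ b
  | _, .all φ, b => ⨅ x : M.carrier, M.realize a φ (Fin.snoc b x)

/-- The truth value of a sentence. -/
def truthValue (M : BStructure.{u, v, w, w'} L 𝔹) (φ : L.Sentence) : 𝔹 :=
  M.realize Empty.elim φ Fin.elim0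

/-- `Γ` forces the sentence `φ` in `M`. -/
def Forces (Γ : 𝔹) (M : BStructure.{u, v, w, w'} L 𝔹) (φ : L.Sentence) : Prop :=
  Γ ≤ M.truthValue φ

end BStructure

/-! ### The language of set theory and the sentence `CH` -/

namespace ZFC

/-- Function symbols: `∅`, `ω`, `𝒫(-)`, `⋃(-)` and the ordered pair `(-,-)`. -/
inductive Func : ℕ → Type
  | emptyset : Func 0
  | omega : Func 0
  | powerset : Func 1
  | union : Func 1
  | pair : Func 2

/-- The only relation symbol is membership. -/
inductive Rel : ℕ → Type
  | mem : Rel 2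

/-- The language of set theory. -/
def lang : FirstOrder.Language.{0, 0} := ⟨Func, Rel⟩

/-- Terms in the variables `0, …, n - 1`. -/
abbrev Tm (n : ℕ) : Type := lang.Term (Empty ⊕ Fin n)

/-- Formulas in the variables `0, …, n - 1`. A quantifier binds the variable `n` of a formula in
the variables `0, …, n`. -/
abbrev Fm (n : ℕ) : Type := lang.BoundedFormula Empty n

variable {n : ℕ}

/-- The variable bound by the innermost quantifier. -/
def newVar (n : ℕ) : Tm (n + 1) := .var (.inr (Fin.last n))

/-- A term, viewed under one more quantifier (which binds a variable not occurring in it). -/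
def up (t : Tm n) : Tm (n + 1) := t.relabel (Sum.map id Fin.castSucc)

def emptyT : Tm n := .func (Func.emptyset : lang.Functions 0) ![]
def omegaT : Tm n := .func (Func.omega : lang.Functions 0) ![]
def powersetT (t : Tm n) : Tm n := .func (Func.powerset : lang.Functions 1) ![t]
def pairT (s t : Tm n) : Tm n := .func (Func.pair : lang.Functions 2) ![s, t]

/-- `s ∈ t` -/
def memF (s t : Tm n) : Fm n := .rel (Rel.mem : lang.Relations 2) ![s, t]

/-- `s = t` -/
def eqF (s t : Tm n) : Fm n := .equal s t

/-- `∀ x ∈ t, φ`, where `x` is the new variable of `φ` -/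
def ballF (t : Tm n) (φ : Fm (n + 1)) : Fm n := (memF (newVar n) (up t) ⟹ φ).all

/-- `∃ x ∈ t, φ`, where `x` is the new variable of `φ` -/
def bexF (t : Tm n) (φ : Fm (n + 1)) : Fm n := (memF (newVar n) (up t) ⊓ φ).ex

/-- `s ⊆ t` -/
def subsetF (s t : Tm n) : Fm n := ballF s (memF (newVar n) (up t))

/-- `∀ x y ∈ z, x = y ∨ x ∈ y ∨ y ∈ x` -/
def trichotomyF (z : Tm n) : Fm n :=
  ballF z (ballF (up z)
    (let x := up (newVar n)
     let y := newVar (n + 1)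
     eqF x y ⊔ (memF x y ⊔ memF y x)))

/-- `∀ x, x ⊆ z → x ≠ ∅ → ∃ y ∈ x, ∀ w ∈ x, w ∉ y` -/
def wellfoundedF (z : Tm n) : Fm n :=
  (let x := newVar n
   subsetF x (up z) ⟹ ∼(eqF x emptyT) ⟹
     bexF x (ballF (up x)
       (let y := up (newVar (n + 1))
        let w := newVar (n + 2)
        ∼(memF w y)))).all

/-- `∀ x ∈ z, x ⊆ z` -/
def transitiveF (z : Tm n) : Fm n := ballF z (subsetF (newVar n) (up z))

/-- `z` is an ordinal. -/
def ordF (z : Tm n) : Fm n := trichotomyF z ⊓ (wellfoundedF z ⊓ transitiveF z)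

/-- `f ⊆ s × t`: `∀ p ∈ f, ∃ a ∈ s, ∃ b ∈ t, p = (a, b)` -/
def relationF (s t f : Tm n) : Fm n :=
  ballF f (bexF (up s) (bexF (up (up t))
    (let p := up (up (newVar n))
     let a := up (newVar (n + 1))
     let b := newVar (n + 2)
     eqF p (pairT a b))))

/-- `∀ a ∈ s, ∃ b ∈ t, (a, b) ∈ f` -/
def totalF (s t f : Tm n) : Fm n :=
  ballF s (bexF (up t)
    (let a := up (newVar n)
     let b := newVar (n + 1)
     memF (pairT a b) (up (up f))))

/-- `∀ a b c, (a, b) ∈ f → (a, c) ∈ f → b = c` -/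
def singleValuedF (f : Tm n) : Fm n :=
  (let a := up (up (newVar n))
   let b := up (newVar (n + 1))
   let c := newVar (n + 2)
   let f' := up (up (up f))
   memF (pairT a b) f' ⟹ memF (pairT a c) f' ⟹ eqF b c).all.all.all

/-- `f` is a function from `s` to `t`. -/
def functionF (s t f : Tm n) : Fm n := relationF s t f ⊓ (totalF s t f ⊓ singleValuedF f)

/-- `∀ b ∈ t, ∃ a ∈ s, (a, b) ∈ f` -/
def ontoF (s t f : Tm n) : Fm n :=
  ballF t (bexF (up s)
    (let b := up (newVar n)
     let a := newVar (n + 1)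
     memF (pairT a b) (up (up f))))

/-- `x ≤ y`: there are `S ⊆ y` and a function `f` from `S` onto `x`. -/
def leqF (x y : Tm n) : Fm n :=
  (let S := up (newVar n)
   let f := newVar (n + 1)
   let x' := up (up x)
   let y' := up (up y)
   subsetF S y' ⊓ (functionF S x' f ⊓ ontoF S x' f)).ex.ex

/-- The continuum hypothesis: `∀ x, Ord(x) → x ≤ ω ∨ 𝒫(ω) ≤ x`. -/
def CH : lang.Sentence :=
  (let x : Tm 1 := newVar 0
   ordF x ⟹ leqF x omegaT ⊔ leqF (powersetT omegaT) x).all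

end ZFC

/-! ### Boolean-valued sets -/

/-- `𝔹`-valued sets (`𝔹`-names): a family of `𝔹`-valued sets, each with a truth value in `𝔹`. -/
inductive BSet (𝔹 : Type u) : Type (u + 1)
  | mk (α : Type u) (A : α → BSet 𝔹) (B : α → 𝔹) : BSet 𝔹

namespace BSet

variable {𝔹 : Type u}

/-- The index type of a `𝔹`-valued set. -/
def Idx : BSet 𝔹 → Type u
  | mk α _ _ => α

/-- The indexed family of a `𝔹`-valued set. -/
def func : (x : BSet 𝔹) → x.Idx → BSet 𝔹
  | mk _ A _ => A

/-- The truth values of a `𝔹`-valued set. -/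
def bval : (x : BSet 𝔹) → x.Idx → 𝔹
  | mk _ _ B => B

variable [CompleteBooleanAlgebra 𝔹]

/-- `𝔹`-valued equality. -/
def bvEq : BSet 𝔹 → BSet 𝔹 → 𝔹
  | mk _ A B, mk _ A' B' =>
    (⨅ a, B a ⇨ ⨆ a', B' a' ⊓ bvEq (A a) (A' a')) ⊓
      (⨅ a', B' a' ⇨ ⨆ a, B a ⊓ bvEq (A a) (A' a'))

/-- `𝔹`-valued membership. -/
def bvMem (x y : BSet 𝔹) : 𝔹 := ⨆ a : y.Idx, y.bval a ⊓ bvEq x (y.func a)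

/-- `𝔹`-valued inclusion. -/
def bvSubset (x y : BSet 𝔹) : 𝔹 := ⨅ a : x.Idx, x.bval a ⇨ bvMem (x.func a) y

/-- The canonical name of a pre-set. -/
def check : PSet.{u} → BSet 𝔹
  | .mk α A => mk α (fun a => check (A a)) fun _ => ⊤

/-- The empty `𝔹`-valued set. -/
def empty : BSet 𝔹 := mk PEmpty PEmpty.elim PEmpty.elim

/-- `ω`, the canonical name of the set of finite von Neumann ordinals. -/
def omega : BSet 𝔹 := check PSet.omega

/-- The subset of `x` with a given `𝔹`-valued indicator function. -/
def setOfIndicator (x : BSet 𝔹) (χ : x.Idx → 𝔹) : BSet 𝔹 := mk x.Idx x.func χ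

/-- The power set. -/
def powerset (x : BSet 𝔹) : BSet 𝔹 :=
  mk (x.Idx → 𝔹) (fun χ => x.setOfIndicator χ) fun χ => bvSubset (x.setOfIndicator χ) x

/-- The union of the elements of `x`. -/
def union (x : BSet 𝔹) : BSet 𝔹 :=
  mk (Σ a : x.Idx, (x.func a).Idx) (fun p => (x.func p.1).func p.2)
    fun p => x.bval p.1 ⊓ (x.func p.1).bval p.2

/-- The unordered pair `{x, y}`. -/
def upair (x y : BSet 𝔹) : BSet 𝔹 :=
  mk (ULift.{u} Bool) (fun b => cond b.down x y) fun _ => ⊤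

/-- The Kuratowski ordered pair `{{x}, {x, y}}`. -/
def pair (x y : BSet 𝔹) : BSet 𝔹 := upair (upair x x) (upair x y)

/-! #### Equality is a congruence -/

theorem bvEq_def (x y : BSet 𝔹) :
    bvEq x y = (⨅ a, x.bval a ⇨ bvMem (x.func a) y) ⊓
      (⨅ a', y.bval a' ⇨ ⨆ a, x.bval a ⊓ bvEq (x.func a) (y.func a')) := by
  cases x; cases y; rfl

theorem bvEq_refl (x : BSet 𝔹) : bvEq x x = ⊤ := by
  induction x with
  | mk α A B ih =>
    rw [eq_top_iff]
    refine le_inf (le_iInf fun a => ?_) (le_iInf fun a => ?_) <;>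
    · rw [le_himp_iff]
      refine le_iSup_of_le a (le_inf inf_le_right ?_)
      rw [ih]; exact le_top

theorem bvEq_symm (x y : BSet 𝔹) : bvEq x y = bvEq y x := by
  induction x generalizing y with
  | mk α A B ih =>
    cases y with
    | mk α' A' B' =>
      simp only [bvEq, ih]
      rw [inf_comm]

theorem bvEq_eq (x y : BSet 𝔹) : bvEq x y = bvSubset x y ⊓ bvSubset y x := by
  rw [bvEq_def]
  congr 1
  unfold bvSubset bvMem
  simp only [bvEq_symm (y.func _)]

theorem mem_of_index {x y : BSet 𝔹} {Γ : 𝔹} (h : Γ ≤ bvSubset x y) (a : x.Idx) :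
    Γ ⊓ x.bval a ≤ bvMem (x.func a) y :=
  le_himp_iff.1 (h.trans (iInf_le _ a))

theorem bvEq_trans (x y z : BSet 𝔹) : bvEq x y ⊓ bvEq y z ≤ bvEq x z := by
  induction x generalizing y z with
  | mk α A B ih =>
    have key : ∀ (a : α) (y z : BSet 𝔹),
        bvEq (A a) y ⊓ bvEq y z ≤ bvEq (A a) z := fun a y z => ih a y z
    rw [bvEq_eq (mk α A B) z]
    refine le_inf (le_iInf fun a => ?_) (le_iInf fun c => ?_)
    · rw [le_himp_iff]
      have h1 : bvEq (mk α A B) y ⊓ B a ≤ bvMem (A a) y :=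
        mem_of_index (x := mk α A B) ((bvEq_eq _ _).le.trans inf_le_left) a
      have h2 : bvEq (mk α A B) y ⊓ bvEq y z ⊓ B a ≤ bvMem (A a) y ⊓ bvEq y z :=
        le_inf ((inf_le_inf_right _ inf_le_left).trans h1) (inf_le_left.trans inf_le_right)
      refine h2.trans ?_
      unfold bvMem
      rw [iSup_inf_eq]
      refine iSup_le fun b => ?_
      have h3 : bvEq y z ⊓ y.bval b ≤ bvMem (y.func b) z :=
        mem_of_index ((bvEq_eq _ _).le.trans inf_le_left) b
      have h4 : y.bval b ⊓ bvEq (A a) (y.func b) ⊓ bvEq y z ≤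
          bvMem (y.func b) z ⊓ bvEq (A a) (y.func b) :=
        le_inf ((le_inf inf_le_right (inf_le_left.trans inf_le_left)).trans h3)
          (inf_le_left.trans inf_le_right)
      refine h4.trans ?_
      unfold bvMem
      rw [iSup_inf_eq]
      refine iSup_mono fun c => le_inf (inf_le_left.trans inf_le_left) ?_
      exact (le_inf inf_le_right (inf_le_left.trans inf_le_right)).trans (key a _ _)
    · rw [le_himp_iff]
      have h1 : bvEq y z ⊓ z.bval c ≤ bvMem (z.func c) y :=
        mem_of_index ((bvEq_eq _ _).le.trans inf_le_right) c
      have h2 : bvEq (mk α A B) y ⊓ bvEq y z ⊓ z.bval c ≤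
          bvMem (z.func c) y ⊓ bvEq (mk α A B) y :=
        le_inf ((inf_le_inf_right _ inf_le_right).trans h1) (inf_le_left.trans inf_le_left)
      refine h2.trans ?_
      unfold bvMem
      rw [iSup_inf_eq]
      refine iSup_le fun b => ?_
      have h3 : bvEq (mk α A B) y ⊓ y.bval b ≤ bvMem (y.func b) (mk α A B) :=
        mem_of_index ((bvEq_eq _ _).le.trans inf_le_right) b
      have h4 : y.bval b ⊓ bvEq (z.func c) (y.func b) ⊓ bvEq (mk α A B) y ≤
          bvMem (y.func b) (mk α A B) ⊓ bvEq (z.func c) (y.func b) :=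
        le_inf ((le_inf inf_le_right (inf_le_left.trans inf_le_left)).trans h3)
          (inf_le_left.trans inf_le_right)
      refine h4.trans ?_
      unfold bvMem
      rw [iSup_inf_eq]
      refine iSup_mono fun a => le_inf (inf_le_left.trans inf_le_left) ?_
      change _ ≤ bvEq (z.func c) (A a)
      rw [bvEq_symm _ (A a)]
      refine le_trans (le_inf ?_ ?_) (key a (y.func b) _)
      · rw [bvEq_symm (A a)]; exact inf_le_left.trans inf_le_right
      · rw [bvEq_symm (y.func b) (z.func c)]; exact inf_le_right

theorem bvMem_congr_left (x y z : BSet 𝔹) : bvEq x y ⊓ bvMem x z ≤ bvMem y z := by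
  unfold bvMem
  rw [inf_iSup_eq]
  refine iSup_mono fun c => le_inf (inf_le_right.trans inf_le_left) ?_
  refine le_trans (le_inf ?_ (inf_le_right.trans inf_le_right)) (bvEq_trans y x _)
  rw [bvEq_symm y]; exact inf_le_left

theorem bvMem_of_subset (x y z : BSet 𝔹) : bvSubset x y ⊓ bvMem z x ≤ bvMem z y := by
  conv_lhs => unfold bvMem
  rw [inf_iSup_eq]
  refine iSup_le fun a => ?_
  have h : bvSubset x y ⊓ x.bval a ≤ bvMem (x.func a) y := mem_of_index le_rfl a
  refine le_trans (le_inf ?_ ?_) (bvMem_congr_left (x.func a) z y)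
  · rw [bvEq_symm]; exact inf_le_right.trans inf_le_right
  · exact (inf_le_inf_left _ inf_le_left).trans h

theorem bvMem_congr_right (x y z : BSet 𝔹) : bvEq x y ⊓ bvMem z x ≤ bvMem z y :=
  (inf_le_inf_right _ ((bvEq_eq x y).le.trans inf_le_left)).trans (bvMem_of_subset x y z)

theorem bval_le_mem (x : BSet 𝔹) (a : x.Idx) : x.bval a ≤ bvMem (x.func a) x :=
  le_iSup_of_le a (le_inf le_rfl (by rw [bvEq_refl]; exact le_top))

/-- Extensionality. -/
theorem le_bvEq_of_mem {x y : BSet 𝔹} {Γ : 𝔹} (h₁ : ∀ z, Γ ⊓ bvMem z x ≤ bvMem z y)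
    (h₂ : ∀ z, Γ ⊓ bvMem z y ≤ bvMem z x) : Γ ≤ bvEq x y := by
  rw [bvEq_eq]
  refine le_inf (le_iInf fun a => le_himp_iff.2 ?_) (le_iInf fun a => le_himp_iff.2 ?_)
  · exact (inf_le_inf_left _ (bval_le_mem x a)).trans (h₁ _)
  · exact (inf_le_inf_left _ (bval_le_mem y a)).trans (h₂ _)

theorem bvSubset_trans (x y z : BSet 𝔹) : bvSubset x y ⊓ bvSubset y z ≤ bvSubset x z := by
  refine le_iInf fun a => le_himp_iff.2 ?_
  refine le_trans (le_inf (inf_le_left.trans inf_le_right) ?_) (bvMem_of_subset y z _)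
  exact (inf_le_inf_right _ inf_le_left).trans (mem_of_index le_rfl a)

/-- The power set axiom. -/
theorem mem_powerset (x z : BSet 𝔹) : bvMem z (powerset x) = bvSubset z x := by
  apply le_antisymm
  · refine iSup_le fun χ => ?_
    change bvSubset (x.setOfIndicator χ) x ⊓ bvEq z (x.setOfIndicator χ) ≤ _
    refine le_trans (le_inf ?_ inf_le_left) (bvSubset_trans z (x.setOfIndicator χ) x)
    exact inf_le_right.trans ((bvEq_eq _ _).le.trans inf_le_left)
  · refine le_iSup_of_le (fun a : x.Idx => bvMem (x.func a) z) ?_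
    change _ ≤ bvSubset (x.setOfIndicator fun a => bvMem (x.func a) z) x ⊓
      bvEq z (x.setOfIndicator fun a => bvMem (x.func a) z)
    refine le_inf (le_iInf fun a => le_himp_iff.2 (bvMem_of_subset z x _)) ?_
    rw [bvEq_eq]
    refine le_inf (le_iInf fun c => le_himp_iff.2 ?_) (le_iInf fun a => ?_)
    · have h : bvSubset z x ⊓ z.bval c ≤ bvMem (z.func c) x := mem_of_index le_rfl c
      refine (le_inf h (inf_le_right.trans (bval_le_mem z c))).trans ?_
      conv_lhs => enter [1]; unfold bvMem
      rw [iSup_inf_eq]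
      refine iSup_le fun a => le_iSup_of_le a ?_
      change _ ≤ bvMem (x.func a) z ⊓ bvEq (z.func c) (x.func a)
      refine le_inf ?_ (inf_le_left.trans inf_le_right)
      exact (le_inf (inf_le_left.trans inf_le_right) inf_le_right).trans
        (bvMem_congr_left _ _ z)
    · rw [le_himp_iff]
      exact inf_le_right

/-- The union axiom. -/
theorem mem_union (x z : BSet 𝔹) :
    bvMem z (union x) = ⨆ a : x.Idx, x.bval a ⊓ bvMem z (x.func a) := by
  unfold bvMem
  simp only [inf_iSup_eq, ← inf_assoc]
  exact iSup_sigma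

theorem mem_upair (x y z : BSet 𝔹) : bvMem z (upair x y) = bvEq z x ⊔ bvEq z y := by
  apply le_antisymm
  · refine iSup_le fun b => ?_
    rcases b with ⟨_ | _⟩
    · exact inf_le_right.trans le_sup_right
    · exact inf_le_right.trans le_sup_left
  · refine sup_le (le_iSup_of_le (⟨true⟩ : ULift Bool) (le_inf le_top le_rfl))
      (le_iSup_of_le (⟨false⟩ : ULift Bool) (le_inf le_top le_rfl))

theorem powerset_congr (x y : BSet 𝔹) : bvEq x y ≤ bvEq (powerset x) (powerset y) := by
  refine le_bvEq_of_mem (fun z => ?_) fun z => ?_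
  · rw [mem_powerset, mem_powerset, bvEq_eq]
    exact (le_inf inf_le_right (inf_le_left.trans inf_le_left)).trans (bvSubset_trans z x y)
  · rw [mem_powerset, mem_powerset, bvEq_eq]
    exact (le_inf inf_le_right (inf_le_left.trans inf_le_right)).trans (bvSubset_trans z y x)

theorem mem_union_of_mem (x y z : BSet 𝔹) : bvMem z y ⊓ bvMem y x ≤ bvMem z (union x) := by
  rw [mem_union]
  conv_lhs => enter [2]; unfold bvMem
  rw [inf_iSup_eq]
  refine iSup_mono fun a => le_inf (inf_le_right.trans inf_le_left) ?_
  exact (le_inf (inf_le_right.trans inf_le_right) inf_le_left).trans (bvMem_congr_right _ _ _)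

theorem union_mono (x y z : BSet 𝔹) :
    bvSubset x y ⊓ bvMem z (union x) ≤ bvMem z (union y) := by
  rw [mem_union x, inf_iSup_eq]
  refine iSup_le fun a => ?_
  refine le_trans (le_inf (inf_le_right.trans inf_le_right) ?_)
    (mem_union_of_mem y (x.func a) z)
  exact (inf_le_inf_left _ inf_le_left).trans (mem_of_index le_rfl a)

theorem union_congr (x y : BSet 𝔹) : bvEq x y ≤ bvEq (union x) (union y) := by
  rw [bvEq_eq x]
  exact le_bvEq_of_mem (fun z => (inf_le_inf_right _ inf_le_left).trans (union_mono x y z))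
    fun z => (inf_le_inf_right _ inf_le_right).trans (union_mono y x z)

theorem upair_mono (x x' y y' z : BSet 𝔹) :
    bvEq x x' ⊓ bvEq y y' ⊓ bvMem z (upair x y) ≤ bvMem z (upair x' y') := by
  rw [mem_upair, mem_upair, inf_sup_left]
  refine sup_le_sup ?_ ?_
  · exact (le_inf inf_le_right (inf_le_left.trans inf_le_left)).trans (bvEq_trans _ _ _)
  · exact (le_inf inf_le_right (inf_le_left.trans inf_le_right)).trans (bvEq_trans _ _ _)

theorem upair_congr (x x' y y' : BSet 𝔹) :
    bvEq x x' ⊓ bvEq y y' ≤ bvEq (upair x y) (upair x' y') := by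
  refine le_bvEq_of_mem (upair_mono x x' y y') fun z => ?_
  rw [bvEq_symm x, bvEq_symm y]
  exact upair_mono x' x y' y z

theorem pair_congr (x x' y y' : BSet 𝔹) :
    bvEq x x' ⊓ bvEq y y' ≤ bvEq (pair x y) (pair x' y') :=
  (le_inf ((le_inf inf_le_left inf_le_left).trans (upair_congr x x' x x'))
    (upair_congr x x' y y')).trans (upair_congr _ _ _ _)

/-! #### The Boolean-valued structure on `BSet 𝔹` -/

/-- The interpretation of the function symbols. -/
def interpFunc : {n : ℕ} → ZFC.Func n → (Fin n → BSet 𝔹) → BSet 𝔹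
  | _, .emptyset, _ => empty
  | _, .omega, _ => omega
  | _, .powerset, x => powerset (x 0)
  | _, .union, x => union (x 0)
  | _, .pair, x => pair (x 0) (x 1)

/-- The interpretation of membership. -/
def interpRel : {n : ℕ} → ZFC.Rel n → (Fin n → BSet 𝔹) → 𝔹
  | _, .mem, x => bvMem (x 0) (x 1)

/-- The Boolean-valued universe over `𝔹`, as a `𝔹`-valued structure for the language of set
theory. -/
def V (𝔹 : Type u) [CompleteBooleanAlgebra 𝔹] : BStructure.{0, 0, u, u + 1} ZFC.lang 𝔹 where
  carrier := BSet 𝔹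
  funMap := interpFunc
  relMap := interpRel
  eqv := bvEq
  eqv_refl := bvEq_refl
  eqv_symm := bvEq_symm
  eqv_trans := bvEq_trans
  fun_congr := by
    intro n f x y
    cases f with
    | emptyset => exact le_top.trans (bvEq_refl _).ge
    | omega => exact le_top.trans (bvEq_refl _).ge
    | powerset => exact (iInf_le _ 0).trans (powerset_congr _ _)
    | union => exact (iInf_le _ 0).trans (union_congr _ _)
    | pair => exact (le_inf (iInf_le _ 0) (iInf_le _ 1)).trans (pair_congr _ _ _ _)
  rel_congr := by
    intro n R x y
    cases R with
    | mem =>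
      change _ ⊓ bvMem (x 0) (x 1) ≤ bvMem (y 0) (y 1)
      refine le_trans (le_inf (inf_le_left.trans (iInf_le _ 1)) ?_)
        (bvMem_congr_right (x 1) (y 1) (y 0))
      exact (inf_le_inf_right _ (iInf_le _ 0)).trans (bvMem_congr_left _ _ _)

end BSet

/-! ### Regular open algebras -/

/-- The regular elements of a frame form a complete Boolean algebra; the supremum is the
double complement of the supremum in the frame. -/
instance Heyting.Regular.instCompleteBooleanAlgebra {α : Type u} [Order.Frame α] :
    CompleteBooleanAlgebra (Heyting.Regular α) where
  __ := (inferInstance : BooleanAlgebra (Heyting.Regular α))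
  sSup s := Heyting.Regular.toRegular (sSup (Heyting.Regular.val '' s))
  sInf s := ⟨sInf (Heyting.Regular.val '' s), by
    refine le_antisymm (le_sInf ?_) le_compl_compl
    rintro _ ⟨a, ha, rfl⟩
    exact (compl_anti (compl_anti (sInf_le (Set.mem_image_of_mem _ ha)))).trans_eq a.prop⟩
  isLUB_sSup s := by
    refine ⟨fun a ha => ?_, fun b hb => ?_⟩
    · exact (le_sSup (Set.mem_image_of_mem _ ha) : a.val ≤ _).trans le_compl_compl
    · refine (Heyting.Regular.gi.gc _ _).2 (sSup_le ?_)
      rintro _ ⟨a, ha, rfl⟩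
      exact hb ha
  isGLB_sInf s := by
    refine ⟨fun a ha => ?_, fun b hb => ?_⟩
    · exact (sInf_le (Set.mem_image_of_mem _ ha) : _ ≤ a.val)
    · refine (le_sInf ?_ : b.val ≤ _)
      rintro _ ⟨a, ha, rfl⟩
      exact hb ha

/-- The regular open algebra of a topological space: the open sets `U` with `Uᗮᗮ = U`, where `Uᗮ`
is the complement of the closure of `U`. The complement of `U` in the frame of open sets is `Uᗮ`,
see `coe_compl_opens` and `isRegular_opens_iff`. -/
abbrev RegularOpenAlgebra (X : Type u) [TopologicalSpace X] : Type u :=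
  Heyting.Regular (Opens X)

theorem coe_compl_opens {X : Type u} [TopologicalSpace X] (U : Opens X) :
    ((Uᶜ : Opens X) : Set X) = (closure (U : Set X))ᶜ := by
  rw [Opens.coe_compl_eq_interior_compl, _root_.interior_compl]

theorem isRegular_opens_iff {X : Type u} [TopologicalSpace X] (U : Opens X) :
    Heyting.IsRegular U ↔ interior (closure (U : Set X)) = U := by
  rw [Heyting.IsRegular, ← SetLike.coe_set_eq, coe_compl_opens, coe_compl_opens, closure_compl,
    compl_compl]

/-! ### The collapse algebra -/

/-- The underlying set of the ordinal `ℵ₁`. -/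
abbrev AlephOne : Type u := (ω_ 1 : Ordinal.{u}).ToType

/-- The power set of (a copy in the universe of) the natural numbers. -/
abbrev PowOmega : Type u := Set (ULift.{u} ℕ)

/-- Countable partial functions from `ℵ₁` to `𝒫(ω)`. -/
def CollapseCondition : Type u := {p : AlephOne.{u} →. PowOmega.{u} // p.Dom.Countable}

/-- The set of all functions from `ℵ₁` to `𝒫(ω)`. -/
def CollapseSpace : Type u := AlephOne.{u} → PowOmega.{u}

/-- The set of functions that extend a given countable partial function. -/
def principalOpen (p : CollapseCondition.{u}) : Set CollapseSpace.{u} :=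
  {g | ∀ η, ∀ S ∈ p.1 η, g η = S}

/-- The topology with basis the principal open sets. -/
instance : TopologicalSpace CollapseSpace.{u} :=
  generateFrom (Set.range principalOpen)

/-- The collapse algebra. -/
abbrev CollapseAlgebra : Type u := RegularOpenAlgebra CollapseSpace.{u}

/-! Forcing with countable partial functions makes the generic `g` a map from the ground model's
`ℵ₁` onto `𝒫(ω)`. Cardinal arithmetic in the extension and preservation of `ℵ₁` are not needed. A
Boolean-valued ordinal `x` is compared with the canonical names of all `η < ω₁`: either `x` equals
one of them, or it has every one as an element (`bvOrd_le_trichotomy`). In the first case a ground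
model injection of `η` into `ℕ`, reversed, gives `x ≤ ω` (`bvEq_ordName_le_bvLeq_omega`). In the
second, `g` is a partial map on `x`, and it remains to see that it is onto
(`iInf_ordName_mem_le_bvLeq`).

Surjectivity rests on two density arguments. Descending sequences of conditions have lower bounds,
so one condition can decide all statements `n ∈ b` for a name `b ⊆ ω`, and then forces `b` to equal
a ground model set `S` (`exists_le_forall_deciding`). A condition has countable domain, so it can be
extended to force `g η = S` at some unused `η` (`exists_le_graphValue`). The graph of `g` has the
value `graphValue η S` at `(η, S)`; `le_bvLeq` turns such weighted families of pairs into names of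
functions. -/

namespace ZFC

/-! ### Evaluation of formulas in the Boolean-valued universe -/

variable {𝔹 : Type u} [CompleteBooleanAlgebra 𝔹] {n : ℕ}

/-- The value of a term in the Boolean-valued universe. -/
def evalTm (b : Fin n → BSet 𝔹) (t : Tm n) : BSet 𝔹 :=
  (BSet.V 𝔹).realizeTerm (Sum.elim Empty.elim b) t

/-- The truth value of a formula in the Boolean-valued universe. -/
def evalFm (b : Fin n → BSet 𝔹) (φ : Fm n) : 𝔹 :=
  (BSet.V 𝔹).realize Empty.elim φ b

@[simp] theorem evalTm_newVar (b : Fin n → BSet 𝔹) (x : BSet 𝔹) :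
    evalTm (Fin.snoc b x : Fin (n + 1) → BSet 𝔹) (newVar n) = x := by
  change (Fin.snoc b x : Fin (n + 1) → BSet 𝔹) (Fin.last n) = x
  simp

@[simp] theorem evalTm_up (b : Fin n → BSet 𝔹) (x : BSet 𝔹) (t : Tm n) :
    evalTm (Fin.snoc b x : Fin (n + 1) → BSet 𝔹) (up t) = evalTm b t := by
  induction t with
  | var k =>
    rcases k with k | k
    · exact k.elim
    · change (Fin.snoc b x : Fin (n + 1) → BSet 𝔹) (Fin.castSucc k) = b k
      simp
  | func f ts ih =>
    change (BSet.V 𝔹).funMap f _ = (BSet.V 𝔹).funMap f _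
    congr 1
    funext i
    exact ih i

@[simp] theorem evalTm_emptyT (b : Fin n → BSet 𝔹) : evalTm b emptyT = BSet.empty := rfl

@[simp] theorem evalTm_omegaT (b : Fin n → BSet 𝔹) : evalTm b omegaT = BSet.omega := rfl

@[simp] theorem evalTm_powersetT (b : Fin n → BSet 𝔹) (t : Tm n) :
    evalTm b (powersetT t) = BSet.powerset (evalTm b t) := rfl

@[simp] theorem evalTm_pairT (b : Fin n → BSet 𝔹) (s t : Tm n) :
    evalTm b (pairT s t) = BSet.pair (evalTm b s) (evalTm b t) := rfl

@[simp] theorem evalFm_memF (b : Fin n → BSet 𝔹) (s t : Tm n) :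
    evalFm b (memF s t) = BSet.bvMem (evalTm b s) (evalTm b t) := rfl

@[simp] theorem evalFm_eqF (b : Fin n → BSet 𝔹) (s t : Tm n) :
    evalFm b (eqF s t) = BSet.bvEq (evalTm b s) (evalTm b t) := rfl

@[simp] theorem evalFm_imp (b : Fin n → BSet 𝔹) (φ ψ : Fm n) :
    evalFm b (φ ⟹ ψ) = evalFm b φ ⇨ evalFm b ψ := rfl

@[simp] theorem evalFm_not (b : Fin n → BSet 𝔹) (φ : Fm n) :
    evalFm b (∼φ) = (evalFm b φ)ᶜ := by
  change evalFm b φ ⇨ ⊥ = _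
  rw [himp_bot]

@[simp] theorem evalFm_all (b : Fin n → BSet 𝔹) (φ : Fm (n + 1)) :
    evalFm b φ.all = ⨅ x : BSet 𝔹, evalFm (Fin.snoc b x : Fin (n + 1) → BSet 𝔹) φ := rfl

-- The quantifier `∃` abbreviates `¬∀¬`, so this is De Morgan's law for infima; disjunction and
-- conjunction below are likewise abbreviations, resolved by Boolean identities.
@[simp] theorem evalFm_ex (b : Fin n → BSet 𝔹) (φ : Fm (n + 1)) :
    evalFm b φ.ex = ⨆ x : BSet 𝔹, evalFm (Fin.snoc b x : Fin (n + 1) → BSet 𝔹) φ := by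
  change evalFm b (∼(∼φ).all) = _
  simp [compl_iInf]

@[simp] theorem evalFm_sup (b : Fin n → BSet 𝔹) (φ ψ : Fm n) :
    evalFm b (φ ⊔ ψ) = evalFm b φ ⊔ evalFm b ψ := by
  change evalFm b (∼φ ⟹ ψ) = _
  simp [himp_eq, sup_comm]

@[simp] theorem evalFm_inf (b : Fin n → BSet 𝔹) (φ ψ : Fm n) :
    evalFm b (φ ⊓ ψ) = evalFm b φ ⊓ evalFm b ψ := by
  change evalFm b (∼(φ ⟹ ∼ψ)) = _
  simp [himp_eq, inf_comm]

@[simp] theorem evalFm_ballF (b : Fin n → BSet 𝔹) (t : Tm n) (φ : Fm (n + 1)) :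
    evalFm b (ballF t φ) = ⨅ x : BSet 𝔹, BSet.bvMem x (evalTm b t) ⇨
      evalFm (Fin.snoc b x : Fin (n + 1) → BSet 𝔹) φ := by
  simp [ballF]

@[simp] theorem evalFm_bexF (b : Fin n → BSet 𝔹) (t : Tm n) (φ : Fm (n + 1)) :
    evalFm b (bexF t φ) = ⨆ x : BSet 𝔹, BSet.bvMem x (evalTm b t) ⊓
      evalFm (Fin.snoc b x : Fin (n + 1) → BSet 𝔹) φ := by
  simp [bexF]

end ZFC

/-! ### The truth value of `CH` as an element of the algebra -/

namespace BSet

variable {𝔹 : Type u} [CompleteBooleanAlgebra 𝔹]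

/-- The truth value of `x` is an ordinal. -/
def bvOrd (x : BSet 𝔹) : 𝔹 :=
  (⨅ y, bvMem y x ⇨ ⨅ z, bvMem z x ⇨ bvEq y z ⊔ (bvMem y z ⊔ bvMem z y)) ⊓
    ((⨅ s, (⨅ y, bvMem y s ⇨ bvMem y x) ⇨ (bvEq s empty)ᶜ ⇨
        ⨆ y, bvMem y s ⊓ ⨅ w, bvMem w s ⇨ (bvMem w y)ᶜ) ⊓
      ⨅ y, bvMem y x ⇨ ⨅ z, bvMem z y ⇨ bvMem z x)

/-- The truth value of there is a function from a subset of `y` onto `x`. -/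
def bvLeq (x y : BSet 𝔹) : 𝔹 :=
  ⨆ S, ⨆ f, (⨅ a, bvMem a S ⇨ bvMem a y) ⊓
    (((⨅ p, bvMem p f ⇨ ⨆ a, bvMem a S ⊓ ⨆ b, bvMem b x ⊓ bvEq p (pair a b)) ⊓
      ((⨅ a, bvMem a S ⇨ ⨆ b, bvMem b x ⊓ bvMem (pair a b) f) ⊓
        ⨅ a, ⨅ b, ⨅ c, bvMem (pair a b) f ⇨ bvMem (pair a c) f ⇨ bvEq b c)) ⊓
      ⨅ b, bvMem b x ⇨ ⨆ a, bvMem a S ⊓ bvMem (pair a b) f)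

theorem evalFm_ordF {n : ℕ} (b : Fin n → BSet 𝔹) (t : ZFC.Tm n) :
    ZFC.evalFm b (ZFC.ordF t) = bvOrd (ZFC.evalTm b t) := by
  simp only [ZFC.ordF, ZFC.trichotomyF, ZFC.wellfoundedF, ZFC.transitiveF, ZFC.subsetF, bvOrd,
    ZFC.evalFm_inf, ZFC.evalFm_sup, ZFC.evalFm_all, ZFC.evalFm_imp, ZFC.evalFm_not,
    ZFC.evalFm_ballF, ZFC.evalFm_bexF, ZFC.evalFm_memF, ZFC.evalFm_eqF, ZFC.evalTm_up,
    ZFC.evalTm_newVar, ZFC.evalTm_emptyT]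

theorem evalFm_leqF {n : ℕ} (b : Fin n → BSet 𝔹) (s t : ZFC.Tm n) :
    ZFC.evalFm b (ZFC.leqF s t) = bvLeq (ZFC.evalTm b s) (ZFC.evalTm b t) := by
  simp only [ZFC.leqF, ZFC.functionF, ZFC.relationF, ZFC.totalF, ZFC.singleValuedF, ZFC.ontoF,
    ZFC.subsetF, bvLeq,
    ZFC.evalFm_inf, ZFC.evalFm_all, ZFC.evalFm_ex, ZFC.evalFm_imp,
    ZFC.evalFm_ballF, ZFC.evalFm_bexF, ZFC.evalFm_memF, ZFC.evalFm_eqF, ZFC.evalTm_up,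
    ZFC.evalTm_newVar, ZFC.evalTm_pairT]

theorem truthValue_CH :
    (V 𝔹).truthValue ZFC.CH =
      ⨅ x : BSet 𝔹, bvOrd x ⇨ bvLeq x omega ⊔ bvLeq (powerset omega) x := by
  change ZFC.evalFm (Fin.elim0 : Fin 0 → BSet 𝔹) ZFC.CH = _
  simp only [ZFC.CH, ZFC.evalFm_all, ZFC.evalFm_imp, ZFC.evalFm_sup, evalFm_ordF, evalFm_leqF,
    ZFC.evalTm_newVar, ZFC.evalTm_omegaT, ZFC.evalTm_powersetT]

end BSet

/-! ### Natural deduction in a complete Boolean algebra -/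

section NaturalDeduction

variable {𝔹 : Type u} [CompleteBooleanAlgebra 𝔹] {Γ a b c : 𝔹}

/-- Here `Γ` acts as a context of hypotheses, and passing to `Γ' ≤ Γ` adds a hypothesis. Elimination
of a disjunction is then distributivity. -/
theorem le_of_le_sup (h : Γ ≤ a ⊔ b) (h₁ : ∀ Γ' ≤ Γ, Γ' ≤ a → Γ' ≤ c)
    (h₂ : ∀ Γ' ≤ Γ, Γ' ≤ b → Γ' ≤ c) : Γ ≤ c := by
  rw [← inf_eq_left.2 h, inf_sup_left]
  exact sup_le (h₁ _ inf_le_left inf_le_right) (h₂ _ inf_le_left inf_le_right)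

theorem le_of_le_iSup {ι : Sort*} {f : ι → 𝔹} (h : Γ ≤ ⨆ i, f i)
    (h₁ : ∀ i, ∀ Γ' ≤ Γ, Γ' ≤ f i → Γ' ≤ c) : Γ ≤ c := by
  rw [← inf_eq_left.2 h, inf_iSup_eq]
  exact iSup_le fun i => h₁ i _ inf_le_left inf_le_right

theorem le_himp_of_forall (h : ∀ Γ' ≤ Γ, Γ' ≤ a → Γ' ≤ b) : Γ ≤ a ⇨ b :=
  le_himp_iff.2 (h _ inf_le_left inf_le_right)

theorem le_of_le_himp (h : Γ ≤ a ⇨ b) (h' : Γ ≤ a) : Γ ≤ b :=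
  (le_inf h h').trans himp_inf_le

theorem le_compl_of_forall (h : ∀ Γ' ≤ Γ, Γ' ≤ a → Γ' ≤ ⊥) : Γ ≤ aᶜ := by
  rw [← himp_bot]
  exact le_himp_of_forall h

theorem le_of_le_compl (h : Γ ≤ aᶜ) (h' : Γ ≤ a) : Γ ≤ b :=
  (le_inf h' h).trans (by simp)

theorem le_of_cases (a : 𝔹) (h₁ : ∀ Γ' ≤ Γ, Γ' ≤ a → Γ' ≤ c)
    (h₂ : ∀ Γ' ≤ Γ, Γ' ≤ aᶜ → Γ' ≤ c) : Γ ≤ c :=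
  le_of_le_sup (a := a) (b := aᶜ) (by simp) h₁ h₂

end NaturalDeduction

/-! ### Equality, ordered pairs and names of functions -/

namespace BSet

variable {𝔹 : Type u} [CompleteBooleanAlgebra 𝔹] {Γ : 𝔹} {x y z : BSet 𝔹}

theorem le_bvEq_symm (h : Γ ≤ bvEq x y) : Γ ≤ bvEq y x := bvEq_symm x y ▸ h

theorem le_bvEq_trans (h : Γ ≤ bvEq x y) (h' : Γ ≤ bvEq y z) : Γ ≤ bvEq x z :=
  (le_inf h h').trans (bvEq_trans x y z)

theorem le_bvEq_refl (x : BSet 𝔹) : Γ ≤ bvEq x x := by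
  rw [bvEq_refl]
  exact le_top

theorem le_bvMem_of_eq_left (h : Γ ≤ bvEq x y) (h' : Γ ≤ bvMem x z) : Γ ≤ bvMem y z :=
  (le_inf h h').trans (bvMem_congr_left x y z)

theorem le_bvMem_of_eq_right (h : Γ ≤ bvEq x y) (h' : Γ ≤ bvMem z x) : Γ ≤ bvMem z y :=
  (le_inf h h').trans (bvMem_congr_right x y z)

theorem le_bvMem_func {a : x.Idx} (h : Γ ≤ x.bval a) : Γ ≤ bvMem (x.func a) x :=
  h.trans (bval_le_mem x a)

theorem bvMem_mk (y : BSet 𝔹) {ι : Type u} (A : ι → BSet 𝔹) (B : ι → 𝔹) :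
    bvMem y (mk ι A B) = ⨆ i, B i ⊓ bvEq y (A i) := rfl

theorem le_bvMem_mk (y : BSet 𝔹) {ι : Type u} {A : ι → BSet 𝔹} {B : ι → 𝔹} (i : ι)
    (h : Γ ≤ B i) (h' : Γ ≤ bvEq y (A i)) : Γ ≤ bvMem y (mk ι A B) :=
  (le_inf h h').trans (le_iSup (fun i => B i ⊓ bvEq y (A i)) i)

theorem le_bvMem_upair_iff : Γ ≤ bvMem z (upair x y) ↔ Γ ≤ bvEq z x ⊔ bvEq z y := by
  rw [mem_upair]

theorem le_bvMem_upair_left (x y : BSet 𝔹) : Γ ≤ bvMem x (upair x y) :=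
  le_bvMem_upair_iff.2 ((le_bvEq_refl x).trans le_sup_left)

theorem le_bvMem_upair_right (x y : BSet 𝔹) : Γ ≤ bvMem y (upair x y) :=
  le_bvMem_upair_iff.2 ((le_bvEq_refl y).trans le_sup_right)

theorem le_bvEq_of_singleton_eq (h : Γ ≤ bvEq (upair x x) (upair y z)) : Γ ≤ bvEq x y := by
  have := le_bvMem_of_eq_right (le_bvEq_symm h) (le_bvMem_upair_left y z)
  rw [le_bvMem_upair_iff, sup_idem] at this
  exact le_bvEq_symm this

theorem le_bvEq_of_pair_eq_left {a b c d : BSet 𝔹} (h : Γ ≤ bvEq (pair a b) (pair c d)) :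
    Γ ≤ bvEq a c := by
  refine le_of_le_sup (le_bvMem_upair_iff.1 (le_bvMem_of_eq_right h (le_bvMem_upair_left _ _)))
    (fun Γ' _ h' => le_bvEq_of_singleton_eq h') fun Γ' _ h' => le_bvEq_of_singleton_eq h'

/-- Kuratowski's argument. Either `{a, b} = {c, d}`, and then `b = d` or `b = c = a = d`; or `{a, b}
= {c}`, and then `{c, d}` is `{a, b}` again or `{a}`, the latter making all four equal. -/
theorem le_bvEq_of_pair_eq_right {a b c d : BSet 𝔹} (h : Γ ≤ bvEq (pair a b) (pair c d)) :
    Γ ≤ bvEq b d := by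
  have hac := le_bvEq_of_pair_eq_left h
  have key : ∀ Γ' ≤ Γ, Γ' ≤ bvEq (upair a b) (upair c d) → Γ' ≤ bvEq b d := by
    intro Γ' hΓ h₁
    refine le_of_le_sup (le_bvMem_upair_iff.1 (le_bvMem_of_eq_right h₁ (le_bvMem_upair_right _ _)))
      (fun Δ hΔ h₂ => ?_) fun _ _ h₂ => h₂
    refine le_of_le_sup (le_bvMem_upair_iff.1 (le_bvMem_of_eq_right
      (le_bvEq_symm (hΔ.trans h₁)) (le_bvMem_upair_right _ _)))
      (fun E hE h₃ => ?_) fun _ _ h₃ => le_bvEq_symm h₃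
    exact le_bvEq_trans (hE.trans h₂) (le_bvEq_trans
      (le_bvEq_symm (hE.trans (hΔ.trans (hΓ.trans hac)))) (le_bvEq_symm h₃))
  refine le_of_le_sup (le_bvMem_upair_iff.1 (le_bvMem_of_eq_right h (le_bvMem_upair_right _ _)))
    (fun Γ' hΓ h₁ => ?_) key
  refine le_of_le_sup (le_bvMem_upair_iff.1 (le_bvMem_of_eq_right
    (le_bvEq_symm (hΓ.trans h)) (le_bvMem_upair_right _ _)))
    (fun Δ hΔ h₂ => ?_) fun Δ hΔ h₂ => key Δ (hΔ.trans hΓ) (le_bvEq_symm h₂)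
  have hbc : Δ ≤ bvEq b c := by
    have := le_bvMem_of_eq_right (hΔ.trans h₁) (le_bvMem_upair_right a b)
    rwa [le_bvMem_upair_iff, sup_idem] at this
  have hda : Δ ≤ bvEq d a := by
    have := le_bvMem_of_eq_right h₂ (le_bvMem_upair_right c d)
    rwa [le_bvMem_upair_iff, sup_idem] at this
  exact le_bvEq_trans hbc (le_bvEq_trans (le_bvEq_symm (hΔ.trans (hΓ.trans hac)))
    (le_bvEq_symm hda))

/-- A family of pairs that is forced to be single-valued defines a function from a subset of `y`
onto `x`. -/
theorem le_bvLeq {ι : Type u} (s t : ι → BSet 𝔹) (c : ι → 𝔹)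
    (hs : ∀ i, Γ ⊓ c i ≤ bvMem (s i) y) (ht : ∀ i, Γ ⊓ c i ≤ bvMem (t i) x)
    (honto : ∀ b, Γ ⊓ bvMem b x ≤ ⨆ i, c i ⊓ bvEq b (t i))
    (hst : ∀ i j, Γ ⊓ (c i ⊓ c j) ⊓ bvEq (s i) (s j) ≤ bvEq (t i) (t j)) :
    Γ ≤ bvLeq x y := by
  -- The domain and the graph carry the same weights `c`, so each index contributes a point and its
  -- value together.
  refine le_iSup_of_le (mk ι s c) (le_iSup_of_le (mk ι (fun i => pair (s i) (t i)) c) ?_)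
  refine le_inf ?_ (le_inf (le_inf ?_ (le_inf ?_ ?_)) ?_)
  · refine le_iInf fun a => le_himp_of_forall fun Γ' hΓ h => ?_
    refine le_of_le_iSup h fun i Δ hΔ h' => ?_
    exact le_bvMem_of_eq_left (le_bvEq_symm (h'.trans inf_le_right))
      ((le_inf (hΔ.trans hΓ) (h'.trans inf_le_left)).trans (hs i))
  · refine le_iInf fun p => le_himp_of_forall fun Γ' hΓ h => ?_
    refine le_of_le_iSup h fun i Δ hΔ h' => ?_
    refine le_iSup_of_le (s i) (le_inf (le_bvMem_mk _ i (h'.trans inf_le_left) (le_bvEq_refl _)) ?_)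
    exact le_iSup_of_le (t i) (le_inf ((le_inf (hΔ.trans hΓ) (h'.trans inf_le_left)).trans (ht i))
      (h'.trans inf_le_right))
  · refine le_iInf fun a => le_himp_of_forall fun Γ' hΓ h => ?_
    refine le_of_le_iSup h fun i Δ hΔ h' => ?_
    refine le_iSup_of_le (t i) (le_inf ((le_inf (hΔ.trans hΓ) (h'.trans inf_le_left)).trans (ht i))
      (le_bvMem_mk _ i (h'.trans inf_le_left) ?_))
    exact (le_inf (h'.trans inf_le_right) (le_bvEq_refl _)).trans (pair_congr _ _ _ _)
  · refine le_iInf fun a => le_iInf fun b => le_iInf fun d => ?_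
    refine le_himp_of_forall fun Γ₁ hΓ₁ h₁ => le_himp_of_forall fun Γ₂ hΓ₂ h₂ => ?_
    refine le_of_le_iSup (hΓ₂.trans h₁) fun i Γ₃ hΓ₃ h₃ => ?_
    refine le_of_le_iSup (hΓ₃.trans h₂) fun j Γ₄ hΓ₄ h₄ => ?_
    have e₃ := (hΓ₄.trans h₃).trans inf_le_right
    have e₄ := h₄.trans inf_le_right
    -- Both `s i` and `s j` equal the common first coordinate `a`, so `hst` applies.
    have hs' := le_bvEq_trans (le_bvEq_symm (le_bvEq_of_pair_eq_left e₃))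
      (le_bvEq_of_pair_eq_left e₄)
    refine le_bvEq_trans (le_bvEq_of_pair_eq_right e₃)
      (le_bvEq_trans ?_ (le_bvEq_symm (le_bvEq_of_pair_eq_right e₄)))
    refine le_trans (le_inf (le_inf ?_ (le_inf ?_ ?_)) hs') (hst i j)
    · exact hΓ₄.trans (hΓ₃.trans (hΓ₂.trans hΓ₁))
    · exact (hΓ₄.trans h₃).trans inf_le_left
    · exact h₄.trans inf_le_left
  · refine le_iInf fun b => le_himp_of_forall fun Γ' hΓ h => ?_
    refine le_of_le_iSup ((le_inf hΓ h).trans (honto b)) fun i Δ hΔ h' => ?_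
    refine le_iSup_of_le (s i) (le_inf (le_bvMem_mk _ i (h'.trans inf_le_left) (le_bvEq_refl _)) ?_)
    exact le_bvMem_mk _ i (h'.trans inf_le_left)
      ((le_inf (le_bvEq_refl _) (h'.trans inf_le_right)).trans (pair_congr _ _ _ _))

/-- Induction on names: where `x` equals its own element `A a`, that element belongs to itself. -/
theorem bvMem_self (x : BSet 𝔹) : bvMem x x = ⊥ := by
  induction x with
  | mk α A B ih =>
    refine le_bot_iff.1 (iSup_le fun a => ?_)
    rw [← ih a]
    refine le_bvMem_of_eq_right (x := mk α A B) inf_le_right ?_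
    exact le_bvMem_func (x := mk α A B) (a := a) inf_le_left

/-- This separates canonical names: of two distinct ordinals, one is an element of the other with
value `⊤`. -/
theorem bvEq_eq_bot_of_bvMem (h : bvMem x y = ⊤) : bvEq x y = ⊥ := by
  rw [← le_bot_iff, ← bvMem_self y]
  exact le_bvMem_of_eq_left le_rfl (h ▸ le_top)

/-- The set of elements of `x` that are not in `y`. -/
def diff (x y : BSet 𝔹) : BSet 𝔹 :=
  x.setOfIndicator fun a => x.bval a ⊓ (bvMem (x.func a) y)ᶜ

theorem le_bvMem_diff (h : Γ ≤ bvMem z x) (h' : Γ ≤ (bvMem z y)ᶜ) : Γ ≤ bvMem z (diff x y) := by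
  refine le_of_le_iSup h fun a Δ hΔ ha => ?_
  refine le_bvMem_mk _ a (le_inf (ha.trans inf_le_left) ?_) (ha.trans inf_le_right)
  refine le_compl_of_forall fun E hE hm => le_of_le_compl (hE.trans (hΔ.trans h')) ?_
  exact le_bvMem_of_eq_left (le_bvEq_symm (hE.trans (ha.trans inf_le_right))) hm

theorem le_bvMem_of_mem_diff (h : Γ ≤ bvMem z (diff x y)) : Γ ≤ bvMem z x := by
  refine le_of_le_iSup h fun a Δ hΔ ha => ?_
  exact le_bvMem_of_eq_left (le_bvEq_symm (ha.trans inf_le_right))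
    (le_bvMem_func (ha.trans (inf_le_left.trans inf_le_left)))

theorem le_compl_of_mem_diff (h : Γ ≤ bvMem z (diff x y)) : Γ ≤ (bvMem z y)ᶜ := by
  refine le_of_le_iSup h fun a Δ hΔ ha => ?_
  refine le_compl_of_forall fun E hE hm =>
    le_of_le_compl (hE.trans (ha.trans (inf_le_left.trans inf_le_right))) ?_
  exact le_bvMem_of_eq_left (hE.trans (ha.trans inf_le_right)) hm

theorem bvMem_empty (x : BSet 𝔹) : bvMem x empty = ⊥ := by
  refine le_bot_iff.1 (iSup_le fun a => ?_)
  exact PEmpty.elim a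

theorem le_bvEq_of_forall (h₁ : ∀ z, ∀ Γ' ≤ Γ, Γ' ≤ bvMem z x → Γ' ≤ bvMem z y)
    (h₂ : ∀ z, ∀ Γ' ≤ Γ, Γ' ≤ bvMem z y → Γ' ≤ bvMem z x) : Γ ≤ bvEq x y :=
  le_bvEq_of_mem (fun z => h₁ z _ inf_le_left inf_le_right)
    fun z => h₂ z _ inf_le_left inf_le_right

/-! ### Ground model ordinals and their comparison with Boolean-valued ordinals -/

section OrdName

variable {W : Type u} [LinearOrder W] [WellFoundedLT W]

/-- The canonical name of the von Neumann ordinal given by an initial segment of a well-order. -/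
noncomputable def ordName (𝔹 : Type u) [CompleteBooleanAlgebra 𝔹] {W : Type u} [LinearOrder W]
    [WellFoundedLT W] (η : W) : BSet 𝔹 :=
  mk (Set.Iio η) (fun ξ => ordName 𝔹 ξ.1) fun _ => ⊤
termination_by (wellFounded_lt (α := W)).wrap η
decreasing_by exact ξ.2

theorem bvMem_ordName (x : BSet 𝔹) (η : W) :
    bvMem x (ordName 𝔹 η) = ⨆ ξ : Set.Iio η, bvEq x (ordName 𝔹 ξ.1) := by
  rw [ordName, bvMem_mk]
  simp

theorem ordName_mem_of_lt {ξ η : W} (h : ξ < η) : bvMem (ordName 𝔹 ξ) (ordName 𝔹 η) = ⊤ := by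
  rw [bvMem_ordName, eq_top_iff]
  exact le_iSup_of_le ⟨ξ, h⟩ (le_bvEq_refl _)

theorem bvEq_ordName_of_ne {ξ η : W} (h : ξ ≠ η) : bvEq (ordName 𝔹 ξ) (ordName 𝔹 η) = ⊥ := by
  rcases h.lt_or_gt with h | h
  · exact bvEq_eq_bot_of_bvMem (ordName_mem_of_lt h)
  · rw [bvEq_symm]
    exact bvEq_eq_bot_of_bvMem (ordName_mem_of_lt h)

theorem le_bvMem_ordName_of_lt {ξ η : W} (hlt : ξ < η) (h : Γ ≤ bvMem x (ordName 𝔹 ξ)) :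
    Γ ≤ bvMem x (ordName 𝔹 η) := by
  rw [bvMem_ordName] at h ⊢
  exact le_of_le_iSup h fun ζ Δ _ hζ => le_iSup_of_le ⟨ζ.1, ζ.2.trans hlt⟩ hζ

/-- An ordinal that includes a ground model ordinal is equal to it or has it as an element. -/
theorem eq_or_mem_of_ordName_subset {η : W} (hx : Γ ≤ bvOrd x)
    (hsub : ∀ z, ∀ Γ' ≤ Γ, Γ' ≤ bvMem z (ordName 𝔹 η) → Γ' ≤ bvMem z x) :
    Γ ≤ bvEq x (ordName 𝔹 η) ⊔ bvMem (ordName 𝔹 η) x := by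
  have htri := hx.trans inf_le_left
  have hwf := (hx.trans inf_le_right).trans inf_le_left
  have htr := (hx.trans inf_le_right).trans inf_le_right
  -- If `D` is empty then `x` is `η`. Otherwise well-foundedness yields an `∈`-minimal `y` in `D`,
  -- and this `y` turns out to equal `η`.
  set D := diff x (ordName 𝔹 η) with hD
  refine le_of_cases (bvEq D empty) (fun Δ hΔ h => ?_) fun Δ hΔ h => ?_
  · refine le_sup_of_le_left (le_bvEq_of_forall (fun z E hE hz => ?_)
      fun z E hE hz => hsub z E (hE.trans hΔ) hz)
    refine le_of_cases (bvMem z (ordName 𝔹 η)) (fun _ _ h' => h') fun F hF h' => ?_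
    have := le_bvMem_of_eq_right ((hF.trans hE).trans h) (le_bvMem_diff (hF.trans hz) h')
    rw [bvMem_empty] at this
    exact this.trans bot_le
  · refine le_sup_of_le_right ?_
    have hmin := le_of_le_himp (le_of_le_himp ((hΔ.trans hwf).trans (iInf_le _ D))
      (le_iInf fun y => le_himp_of_forall fun E _ hy => le_bvMem_of_mem_diff hy)) h
    refine le_of_le_iSup hmin fun y E hE hy => ?_
    have hyD := hy.trans inf_le_left
    have hymin := hy.trans inf_le_right
    have hyx := le_bvMem_of_mem_diff hyD
    have hyη := le_compl_of_mem_diff hyD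
    have hEΓ := hE.trans hΔ
    refine le_bvMem_of_eq_left (x := y) (le_bvEq_of_forall (fun z F hF hz => ?_)
      fun z F hF hz => ?_) hyx
    -- Transitivity puts `z ∈ y` in `x`; if `z` were not in `η` it would lie in `D`, against the
    -- minimality of `y`.
    · have hzx := le_of_le_himp ((le_of_le_himp ((hF.trans (hEΓ.trans htr)).trans (iInf_le _ y))
        (hF.trans hyx)).trans (iInf_le _ z)) hz
      refine le_of_cases (bvMem z (ordName 𝔹 η)) (fun _ _ h' => h') fun G hG h' => ?_
      exact le_of_le_compl (le_of_le_himp ((hG.trans (hF.trans hymin)).trans (iInf_le _ z))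
        (le_bvMem_diff (hG.trans hzx) h')) (hG.trans hz)
    -- By trichotomy in `x`, the alternatives to `z ∈ y` are `y = z` and `y ∈ z`; as `z ∈ η`, both
    -- would put `y` in `η`.
    · have hzx := hsub z F (hF.trans hEΓ) hz
      have := le_of_le_himp ((le_of_le_himp ((hF.trans (hEΓ.trans htri)).trans (iInf_le _ y))
        (hF.trans hyx)).trans (iInf_le _ z)) hzx
      refine le_of_le_sup this (fun G hG h' => ?_) fun G hG h' =>
        le_of_le_sup h' (fun H hH h'' => ?_) fun H hH h'' => h''
      · exact le_of_le_compl (hG.trans (hF.trans hyη))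
          (le_bvMem_of_eq_left (le_bvEq_symm h') (hG.trans hz))
      · refine le_of_le_compl (hH.trans (hG.trans (hF.trans hyη))) ?_
        rw [bvMem_ordName] at hz
        refine le_of_le_iSup ((hH.trans hG).trans hz) fun ξ I hI hξ => ?_
        exact le_bvMem_ordName_of_lt ξ.2 (le_bvMem_of_eq_right hξ (hI.trans h''))

/-- Every ordinal is comparable with every ground model ordinal. -/
theorem bvOrd_le_trichotomy (x : BSet 𝔹) (η : W) :
    bvOrd x ≤ (⨆ ξ : W, bvEq x (ordName 𝔹 ξ)) ⊔ bvMem (ordName 𝔹 η) x := by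
  induction η using WellFoundedLT.induction with
  | ind η ih =>
    -- Where `x` equals no `ξ` at all, the induction hypothesis puts every `ξ < η` in `x`, so `x`
    -- includes `η`.
    refine le_of_cases (⨆ ξ : W, bvEq x (ordName 𝔹 ξ)) (fun Δ hΔ h => le_sup_of_le_left h)
      fun Δ hΔ h => ?_
    refine le_of_le_sup (eq_or_mem_of_ordName_subset (η := η) hΔ fun z E hE hz => ?_)
      (fun E hE h' => le_sup_of_le_left (le_iSup_of_le η h')) fun E hE h' => le_sup_of_le_right h'
    rw [bvMem_ordName] at hz
    refine le_of_le_iSup hz fun ξ F hF hξ => le_bvMem_of_eq_left (le_bvEq_symm hξ) ?_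
    refine le_of_le_sup ((hF.trans (hE.trans hΔ)).trans (ih ξ.1 ξ.2)) (fun G hG h' => ?_)
      fun G hG h' => h'
    exact le_of_le_compl (hG.trans (hF.trans (hE.trans h))) h'

end OrdName

/-! ### Names of natural numbers and countable ordinals -/

theorem check_mem_insert (s t : PSet.{u}) (x : BSet 𝔹) :
    bvMem x (check (insert s t)) = bvEq x (check s) ⊔ bvMem x (check t) := by
  obtain ⟨α, A⟩ := t
  -- The index type of `insert s t` is an `Option`, with `none` standing for the new element `s`.
  change ⨆ o : Option α, ⊤ ⊓ bvEq x (check (Option.rec s A o)) = _ ⊔ ⨆ a : α, ⊤ ⊓ _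
  rw [iSup_option]
  simp
  rfl

theorem check_ofNat_mem_of_lt {m n : ℕ} (h : m < n) :
    bvMem (check (PSet.ofNat.{u} m) : BSet 𝔹) (check (PSet.ofNat.{u} n)) = ⊤ := by
  induction n with
  | zero => omega
  | succ n ih =>
    change bvMem _ (check (insert (PSet.ofNat n) (PSet.ofNat n))) = ⊤
    rw [check_mem_insert]
    rcases (Nat.lt_succ_iff.1 h).lt_or_eq with h | rfl
    · rw [ih h, sup_top_eq]
    · rw [bvEq_refl, top_sup_eq]

theorem bvEq_check_ofNat_of_ne {m n : ℕ} (h : m ≠ n) :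
    bvEq (check (PSet.ofNat.{u} m) : BSet 𝔹) (check (PSet.ofNat.{u} n)) = ⊥ := by
  rcases h.lt_or_gt with h | h
  · exact bvEq_eq_bot_of_bvMem (check_ofNat_mem_of_lt h)
  · rw [bvEq_symm]
    exact bvEq_eq_bot_of_bvMem (check_ofNat_mem_of_lt h)

theorem le_check_ofNat_mem_omega (n : ℕ) : Γ ≤ bvMem (check (PSet.ofNat n)) omega :=
  le_bvMem_mk (A := fun a : ULift.{u} ℕ => check (PSet.ofNat a.down)) _ ⟨n⟩ le_top (le_bvEq_refl _)

/-- A countable ground model ordinal is forced to be countable. -/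
theorem bvEq_ordName_le_bvLeq_omega {W : Type u} [LinearOrder W] [WellFoundedLT W] (x : BSet 𝔹)
    (η : W) (hη : (Set.Iio η).Countable) : bvEq x (ordName 𝔹 η) ≤ bvLeq x omega := by
  obtain ⟨e, he⟩ := hη.to_subtype.exists_injective_nat
  -- The function sends `e ξ` to `ξ`; it is single-valued because `e` is injective and distinct
  -- numbers have names that are equal with value `⊥`. A partial domain in `ω` suffices, so `η` may
  -- be empty.
  refine le_bvLeq (ι := Set.Iio η) (fun ξ => check (PSet.ofNat (e ξ)))
    (fun ξ => ordName 𝔹 ξ.1) (fun _ => ⊤) (fun ξ => le_check_ofNat_mem_omega _) (fun ξ => ?_)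
    (fun b => ?_) fun ξ ζ => ?_
  · refine le_bvMem_of_eq_right (le_bvEq_symm inf_le_left) ?_
    rw [ordName_mem_of_lt ξ.2]
    exact le_top
  · have := le_bvMem_of_eq_right (Γ := bvEq x (ordName 𝔹 η) ⊓ bvMem b x) inf_le_left inf_le_right
    rw [bvMem_ordName] at this
    simpa using this
  · by_cases h : ξ = ζ
    · subst h
      exact le_bvEq_refl _
    · rw [bvEq_check_ofNat_of_ne (he.ne h)]
      exact inf_le_right.trans bot_le

end BSet

/-! ### Cylinders in the collapse space -/

theorem AlephOne.mk : Cardinal.mk AlephOne.{u} = Cardinal.aleph 1 := by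
  rw [Cardinal.mk_toType, Ordinal.card_omega]

theorem AlephOne.countable_Iio (η : AlephOne.{u}) : (Set.Iio η).Countable := by
  rw [← Cardinal.le_aleph0_iff_set_countable, ← Order.lt_succ_iff, Cardinal.succ_aleph0,
    ← AlephOne.mk]
  refine Cardinal.mk_Iio_lt η ?_
  rw [AlephOne.mk, Cardinal.ord_aleph, Ordinal.type_toType]

theorem AlephOne.exists_notMem {A : Set AlephOne.{u}} (hA : A.Countable) : ∃ η, η ∉ A := by
  by_contra! h
  rw [Set.eq_univ_of_forall h, ← Cardinal.le_aleph0_iff_set_countable, Cardinal.mk_univ,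
    AlephOne.mk] at hA
  exact hA.not_gt Cardinal.aleph0_lt_aleph_one

namespace CollapseSpace

/-- A condition, given by its countable domain and an arbitrary extension to a total function. -/
structure Cond : Type u where
  dom : Set AlephOne.{u}
  countable_dom : dom.Countable
  fn : CollapseSpace.{u}

namespace Cond

/-- The functions that extend a condition. -/
def cylinder (p : Cond.{u}) : Set CollapseSpace.{u} := {g | ∀ η ∈ p.dom, g η = p.fn η}

theorem isOpen_cylinder (p : Cond.{u}) : IsOpen p.cylinder := by
  refine isOpen_generateFrom_of_mem
    ⟨⟨fun η => ⟨η ∈ p.dom, fun _ => p.fn η⟩, p.countable_dom⟩, ?_⟩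
  ext g
  constructor
  · exact fun h η hη => h η _ ⟨hη, rfl⟩
  · rintro h η _ ⟨hη, rfl⟩
    exact h η hη

/-- A function outside the cylinder violates it at one point, and fixing its value there gives a
neighbourhood that misses the cylinder. Being clopen, cylinders are regular open. -/
theorem isClosed_cylinder (p : Cond.{u}) : IsClosed p.cylinder := by
  refine ⟨isOpen_iff_forall_mem_open.2 fun g hg => ?_⟩
  obtain ⟨η, hη, hne⟩ : ∃ η ∈ p.dom, g η ≠ p.fn η := by
    by_contra! h
    exact hg h
  refine ⟨cylinder ⟨{η}, Set.countable_singleton η, g⟩, fun g' hg' h => hne ?_,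
    isOpen_cylinder _, fun _ _ => rfl⟩
  exact (hg' η rfl).symm.trans (h η hη)

/-- The regular open set of functions that extend a condition. -/
def toAlg (p : Cond.{u}) : CollapseAlgebra.{u} :=
  ⟨⟨p.cylinder, p.isOpen_cylinder⟩, (isRegular_opens_iff _).2 <| by
    change interior (closure p.cylinder) = p.cylinder
    rw [p.isClosed_cylinder.closure_eq, p.isOpen_cylinder.interior_eq]⟩

/-- Stronger conditions are smaller. Values of `fn` off `dom` carry no information, so antisymmetry
fails. -/
instance : Preorder Cond.{u} where
  le q p := p.dom ⊆ q.dom ∧ ∀ η ∈ p.dom, q.fn η = p.fn η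
  le_refl _ := ⟨subset_rfl, fun _ _ => rfl⟩
  le_trans _ _ _ h h' :=
    ⟨h'.1.trans h.1, fun η hη => (h.2 η (h'.1 hη)).trans (h'.2 η hη)⟩

theorem toAlg_mono {p q : Cond.{u}} (h : q ≤ p) : q.toAlg ≤ p.toAlg := by
  intro g hg η hη
  exact (hg η (h.1 hη)).trans (h.2 η hη)

theorem toAlg_ne_bot (p : Cond.{u}) : p.toAlg ≠ ⊥ := by
  intro h
  have : p.fn ∈ p.toAlg.val := fun _ _ => rfl
  rw [h] at this
  exact this

end Cond

/-- Induction on the generation of the topology: only binary intersections enlarge the domain, so it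
stays countable. -/
theorem exists_cylinder_subset {U : Set CollapseSpace.{u}} (hU : IsOpen U) {g : CollapseSpace.{u}}
    (hg : g ∈ U) : ∃ (A : Set AlephOne.{u}) (hA : A.Countable), Cond.cylinder ⟨A, hA, g⟩ ⊆ U := by
  induction hU with
  | basic s hs =>
    obtain ⟨p, rfl⟩ := hs
    refine ⟨p.1.Dom, p.2, fun g' hg' η S hS => ?_⟩
    rw [hg' η (Part.dom_iff_mem.2 ⟨S, hS⟩)]
    exact hg η S hS
  | univ => exact ⟨∅, Set.countable_empty, Set.subset_univ _⟩
  | inter s t _ _ ihs iht =>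
    obtain ⟨A, hA, hAs⟩ := ihs hg.1
    obtain ⟨B, hB, hBt⟩ := iht hg.2
    exact ⟨A ∪ B, hA.union hB, fun g' hg' => ⟨hAs fun η hη => hg' η (Or.inl hη),
      hBt fun η hη => hg' η (Or.inr hη)⟩⟩
  | sUnion S _ ih =>
    obtain ⟨s, hs, hgs⟩ := hg
    obtain ⟨A, hA, hAs⟩ := ih s hs hgs
    exact ⟨A, hA, hAs.trans (Set.subset_sUnion_of_mem hs)⟩

/-- The conditions are dense. -/
theorem exists_toAlg_le {U : CollapseAlgebra.{u}} (hU : U ≠ ⊥) :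
    ∃ p : Cond.{u}, p.toAlg ≤ U := by
  obtain ⟨g, hg⟩ : (U.val : Set CollapseSpace.{u}).Nonempty := by
    by_contra! h
    refine hU (Heyting.Regular.coe_injective (Opens.ext ?_))
    exact h
  obtain ⟨A, hA, h⟩ := exists_cylinder_subset U.val.isOpen hg
  exact ⟨⟨A, hA, g⟩, h⟩

theorem exists_le_of_inf_ne_bot (p : Cond.{u}) {U : CollapseAlgebra.{u}} (h : p.toAlg ⊓ U ≠ ⊥) :
    ∃ q ≤ p, q.toAlg ≤ U := by
  obtain ⟨q, hq⟩ := exists_toAlg_le h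
  have hqp : ∀ g ∈ q.cylinder, g ∈ p.cylinder := (hq.trans inf_le_left : q.toAlg ≤ p.toAlg)
  -- Since `q.fn` lies in the cylinder of `q`, hence in that of `p`, it already agrees with `p.fn`
  -- on `p.dom`, and the domain can be enlarged.
  refine ⟨⟨p.dom ∪ q.dom, p.countable_dom.union q.countable_dom, q.fn⟩,
    ⟨Set.subset_union_left, hqp q.fn fun _ _ => rfl⟩, le_trans ?_ (hq.trans inf_le_right)⟩
  exact Cond.toAlg_mono ⟨Set.subset_union_right, fun _ _ => rfl⟩

/-- If `U ⊓ Vᶜ` were nonzero, a condition below it would have an extension below both `V` and `Vᶜ`.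
This converts density arguments into inequalities of the algebra. -/
theorem le_of_dense {U V : CollapseAlgebra.{u}}
    (h : ∀ p : Cond.{u}, p.toAlg ≤ U → ∃ q ≤ p, q.toAlg ≤ V) : U ≤ V := by
  by_contra hUV
  have hne : U ⊓ Vᶜ ≠ ⊥ := fun h' =>
    hUV (disjoint_compl_right_iff.1 (disjoint_iff.2 h'))
  obtain ⟨p, hp⟩ := exists_toAlg_le hne
  obtain ⟨q, hqp, hq⟩ := h p (hp.trans inf_le_left)
  refine q.toAlg_ne_bot (le_bot_iff.1 ?_)
  exact le_of_le_compl ((Cond.toAlg_mono hqp).trans (hp.trans inf_le_right)) hq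

theorem exists_le_deciding (p : Cond.{u}) (U : CollapseAlgebra.{u}) :
    ∃ q ≤ p, q.toAlg ≤ U ∨ q.toAlg ≤ Uᶜ := by
  by_cases h : p.toAlg ⊓ U = ⊥
  · exact ⟨p, le_rfl, Or.inr (le_compl_iff_disjoint_right.2 (disjoint_iff.2 h))⟩
  · obtain ⟨q, hqp, hq⟩ := exists_le_of_inf_ne_bot p h
    exact ⟨q, hqp, Or.inl hq⟩

/-- The conditions are closed under limits of descending sequences. -/
theorem exists_le_forall_of_antitone {p : ℕ → Cond.{u}} (hp : Antitone p) : ∃ q, ∀ n, q ≤ p n := by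
  classical
  -- The value at `η` comes from the first condition defined there, with which all later ones agree;
  -- the default `∅` occurs only off the domain.
  refine ⟨⟨⋃ n, (p n).dom, Set.countable_iUnion fun n => (p n).countable_dom,
    fun η => if h : ∃ n, η ∈ (p n).dom then (p (Nat.find h)).fn η else ∅⟩,
    fun n => ⟨Set.subset_iUnion (fun n => (p n).dom) n, fun η hη => ?_⟩⟩
  have h : ∃ n, η ∈ (p n).dom := ⟨n, hη⟩
  change (if h : ∃ n, η ∈ (p n).dom then (p (Nat.find h)).fn η else ∅) = _
  rw [dif_pos h]
  exact ((hp (Nat.find_min' h hη)).2 η (Nat.find_spec h)).symm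

/-- Countably many truth values are decided by a dense set of conditions. -/
theorem exists_le_forall_deciding (p : Cond.{u}) (U : ℕ → CollapseAlgebra.{u}) :
    ∃ q ≤ p, ∀ n, q.toAlg ≤ U n ∨ q.toAlg ≤ (U n)ᶜ := by
  choose f hf hfU using exists_le_deciding
  let r : ℕ → Cond.{u} := fun n => Nat.rec p (fun k s => f s (U k)) n
  obtain ⟨q, hq⟩ := exists_le_forall_of_antitone
    (antitone_nat_of_succ_le fun n => (hf (r n) (U n) : r (n + 1) ≤ r n))
  refine ⟨q, hq 0, fun n => ?_⟩
  -- The value `U n` is decided in the passage from `r n` to `r (n + 1)`.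
  have := Cond.toAlg_mono (hq (n + 1))
  exact (hfU (r n) (U n)).imp this.trans this.trans

/-- The truth value of the generic function maps `η` to `S`. -/
def graphValue (η : AlephOne.{u}) (S : PowOmega.{u}) : CollapseAlgebra.{u} :=
  Cond.toAlg ⟨{η}, Set.countable_singleton η, fun _ => S⟩

theorem graphValue_inf_of_ne (η : AlephOne.{u}) {S T : PowOmega.{u}} (h : S ≠ T) :
    graphValue η S ⊓ graphValue η T = ⊥ := by
  by_contra hne
  obtain ⟨p, hp⟩ := exists_toAlg_le hne
  have h₁ : p.toAlg ≤ graphValue η S := hp.trans inf_le_left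
  have h₂ : p.toAlg ≤ graphValue η T := hp.trans inf_le_right
  have hm : p.fn ∈ p.toAlg.val := fun _ _ => rfl
  exact h ((h₁ hm η rfl).symm.trans (h₂ hm η rfl))

/-- A countable domain misses some `η < ω₁`, where the value `S` can still be prescribed. -/
theorem exists_le_graphValue (p : Cond.{u}) (S : PowOmega.{u}) :
    ∃ q ≤ p, ∃ η, q.toAlg ≤ graphValue η S := by
  classical
  obtain ⟨η, hη⟩ := AlephOne.exists_notMem p.countable_dom
  refine ⟨⟨insert η p.dom, p.countable_dom.insert η, Function.update p.fn η S⟩,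
    ⟨Set.subset_insert _ _, fun ξ hξ => ?_⟩, η, Cond.toAlg_mono ⟨?_, ?_⟩⟩
  · exact Function.update_of_ne (fun h : ξ = η => hη (h ▸ hξ)) _ _
  · exact Set.singleton_subset_iff.2 (Set.mem_insert _ _)
  · rintro _ rfl
    exact Function.update_self _ _ _

end CollapseSpace

/-! ### The generic map onto the power set of `ω` -/

namespace BSet

/-- The canonical name of a ground model subset of `ω`. -/
def subsetName (𝔹 : Type u) [CompleteBooleanAlgebra 𝔹] (S : PowOmega.{u}) : BSet 𝔹 :=
  mk S (fun n => check (PSet.ofNat n.1.down)) fun _ => ⊤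

open CollapseSpace

/-- Every subset of `ω` is forced to be a ground model set in the range of the generic function. -/
theorem bvMem_powerset_omega_le (b : BSet CollapseAlgebra.{u}) :
    bvMem b (powerset omega) ≤ ⨆ i : AlephOne.{u} × PowOmega.{u},
      graphValue i.1 i.2 ⊓ bvEq b (subsetName CollapseAlgebra.{u} i.2) := by
  refine le_of_dense fun p hp => ?_
  rw [mem_powerset] at hp
  obtain ⟨q, hqp, hq⟩ := exists_le_forall_deciding p fun n => bvMem (check (PSet.ofNat n)) b
  have hsub := (Cond.toAlg_mono hqp).trans hp
  -- Since `q` decides every statement `n ∈ b`, the set of those it forces is a ground model set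
  -- that determines `b` below `q`.
  let S : PowOmega.{u} := {n | q.toAlg ≤ bvMem (check (PSet.ofNat n.down)) b}
  have heq : q.toAlg ≤ bvEq b (subsetName CollapseAlgebra.{u} S) := by
    refine le_bvEq_of_forall (fun z Γ hΓ hz => ?_) fun z Γ hΓ hz => ?_
    · have hzω := (le_inf (hΓ.trans hsub) hz).trans (bvMem_of_subset b omega z)
      refine le_of_le_iSup hzω fun (n : ULift ℕ) Δ hΔ hn => ?_
      have hzn : Δ ≤ bvEq z (check (PSet.ofNat n.down)) := hn.trans inf_le_right
      rcases hq n.down with h | h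
      · exact le_bvMem_mk z (⟨n, h⟩ : S) le_top hzn
      · exact le_of_le_compl (hΔ.trans (hΓ.trans h)) (le_bvMem_of_eq_left hzn (hΔ.trans hz))
    · refine le_of_le_iSup hz fun (n : S) Δ hΔ hn => ?_
      exact le_bvMem_of_eq_left (le_bvEq_symm (hn.trans inf_le_right))
        ((hΔ.trans hΓ).trans n.2)
  obtain ⟨r, hrq, η, hr⟩ := exists_le_graphValue q S
  exact ⟨r, hrq.trans hqp, le_iSup_of_le (η, S)
    (le_inf hr ((Cond.toAlg_mono hrq).trans heq))⟩

/-- A set that has all countable ground model ordinals as elements is forced to have at least as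
many elements as there are subsets of `ω`. -/
theorem iInf_ordName_mem_le_bvLeq (x : BSet CollapseAlgebra.{u}) :
    ⨅ η : AlephOne.{u}, bvMem (ordName CollapseAlgebra.{u} η) x ≤ bvLeq (powerset omega) x := by
  refine le_bvLeq (ι := AlephOne.{u} × PowOmega.{u}) (fun i => ordName _ i.1)
    (fun i => subsetName _ i.2) (fun i => graphValue i.1 i.2)
    (fun i => inf_le_left.trans (iInf_le _ i.1)) (fun i => ?_)
    (fun b => inf_le_right.trans (bvMem_powerset_omega_le b)) fun i j => ?_
  · rw [mem_powerset]
    exact le_iInf fun n => le_himp_of_forall fun Γ _ _ => le_check_ofNat_mem_omega _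
  · obtain ⟨η, S⟩ := i
    obtain ⟨ξ, T⟩ := j
    -- For equal arguments, different values have disjoint weights; for different arguments, the
    -- names are equal with value `⊥`.
    by_cases h : η = ξ
    · subst h
      by_cases hST : S = T
      · subst hST
        exact le_bvEq_refl _
      · refine inf_le_left.trans (inf_le_right.trans ?_)
        exact (graphValue_inf_of_ne η hST).le.trans bot_le
    · rw [bvEq_ordName_of_ne h, inf_bot_eq]
      exact bot_le

end BSet

theorem mainTheorem2 :
    BStructure.Forces (⊤ : CollapseAlgebra.{u}) (BSet.V CollapseAlgebra.{u}) ZFC.CH := by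
  rw [BStructure.Forces, BSet.truthValue_CH]
  refine le_iInf fun x => le_himp_of_forall fun Γ _ hx => ?_
  have htri : Γ ≤ (⨆ ξ : AlephOne.{u}, BSet.bvEq x (BSet.ordName _ ξ)) ⊔
      ⨅ η : AlephOne.{u}, BSet.bvMem (BSet.ordName _ η) x := by
    -- The first alternative does not depend on `η`, so the infimum over `η` can be taken outside
    -- the supremum.
    rw [sup_iInf_eq]
    exact le_iInf fun η => hx.trans (BSet.bvOrd_le_trichotomy x η)
  refine htri.trans (sup_le_sup (iSup_le fun η => ?_) (BSet.iInf_ordName_mem_le_bvLeq x))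
  exact BSet.bvEq_ordName_le_bvLeq_omega x η η.countable_Iio
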